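/- For a non-zero polynomial $P\in\mathbb{C}[x,y,z]$ let $$\mathrm{m}(P)=\frac{1}{(2\pi i)^3}\int_{\mathbb{T}^3}\log|P(x,y,z)|\,\frac{dx}{x}\frac{dy}{y}\frac{dz}{z}=\frac{1}{(2\pi)^3}\int_{[0,2\pi]^3}\log|P(e^{i\alpha},e^{i\beta},e^{i\gamma})|\,d\alpha\,d\beta\,d\gamma$$ be its logarithmic Mahler measure, where $\mathbb{T}^3=\{(x,y,z)\in\mathbb{C}^3:|x|=|y|=|z|=1\}$, and let $\zeta$ be the Riemann zeta function. Then, for each of the following three polynomials, the integral converges absolutely, and $$\mathrm{m}\bigl(x^2+x+1+(x^2-1)(y+z)\bigr)=\frac{28}{5\pi^2}\zeta(3),$$ $$\mathrm{m}\bigl(x^4-x^3+x^2-x+1+(x^4-x^3+x-1)(y+z)\bigr)=\frac{28}{5\pi^2}\zeta(3),$$ $$\mathrm{m}\bigl(x^5+x^4+x+1+(x^5-1)(y+z)\bigr)=\frac{28}{5\pi^2}\zeta(3).$$ -/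

import Mathlib

/-- The function `θ ↦ log |P(e^{iθ₁}, …, e^{iθₙ})|`, that is, `log |P|` on the unit torus in angular
coordinates. -/
noncomputable def logNormOnTorus {n : ℕ} (P : MvPolynomial (Fin n) ℂ) (θ : Fin n → ℝ) : ℝ :=
  Real.log ‖MvPolynomial.eval (torusMap 0 1 θ) P‖

/-- `log |P|` is integrable on the unit torus, so that the Mahler measure of `P` exists as a
convergent integral. -/
def MahlerIntegrable {n : ℕ} (P : MvPolynomial (Fin n) ℂ) : Prop :=
  MeasureTheory.IntegrableOn (logNormOnTorus P)
    (Set.Icc (0 : Fin n → ℝ) (fun _ => 2 * Real.pi))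

/-- The logarithmic Mahler measure: the average of `log |P|` over the unit torus with respect to the
normalized Haar measure, `(2π)⁻ⁿ ∫_{[0, 2π]ⁿ} log |P(e^{iθ₁}, …, e^{iθₙ})| dθ`. -/
noncomputable def mvLogMahlerMeasure {n : ℕ} (P : MvPolynomial (Fin n) ℂ) : ℝ :=
  ((2 * Real.pi) ^ n)⁻¹ *
    ∫ θ in Set.Icc (0 : Fin n → ℝ) (fun _ => 2 * Real.pi), logNormOnTorus P θ

/-- The same number written as the contour integral
`(2πi)⁻ⁿ ∫_{𝕋ⁿ} log |P(x₁, …, xₙ)| dx₁/x₁ ⋯ dxₙ/xₙ`. -/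
theorem mvLogMahlerMeasure_eq_torusIntegral {n : ℕ} (P : MvPolynomial (Fin n) ℂ) :
    (mvLogMahlerMeasure P : ℂ) = ((2 * Real.pi * Complex.I) ^ n)⁻¹ *
      torusIntegral (fun x => (Real.log ‖MvPolynomial.eval x P‖ : ℂ) * ∏ i, (x i)⁻¹) 0 1 := by
  have h : ∀ θ : Fin n → ℝ,
      (∏ i, ((1 : Fin n → ℝ) i : ℂ) * Complex.exp (θ i * Complex.I) * Complex.I) •
        ((Real.log ‖MvPolynomial.eval (torusMap 0 1 θ) P‖ : ℂ) *
          ∏ i, (torusMap 0 1 θ i)⁻¹) = Complex.I ^ n * (logNormOnTorus P θ : ℂ) := by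
    intro θ
    have h2 : (∏ i, ((1 : Fin n → ℝ) i : ℂ) * Complex.exp (θ i * Complex.I) * Complex.I) *
        ∏ i, (torusMap 0 1 θ i)⁻¹ = Complex.I ^ n := by
      rw [← Finset.prod_mul_distrib]
      have : ∀ i : Fin n, ((1 : Fin n → ℝ) i : ℂ) * Complex.exp (θ i * Complex.I) * Complex.I *
          (torusMap 0 1 θ i)⁻¹ = Complex.I := by
        intro i
        simp only [torusMap, Pi.one_apply, Pi.zero_apply, Complex.ofReal_one, one_mul, zero_add]
        field_simp
      rw [Finset.prod_congr rfl fun i _ => this i]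
      simp
    rw [smul_eq_mul, logNormOnTorus, ← h2]
    ring
  unfold torusIntegral
  simp only [h]
  rw [MeasureTheory.integral_const_mul, integral_complex_ofReal, mvLogMahlerMeasure]
  push_cast
  rw [mul_pow, mul_inv]
  have : Complex.I ^ n ≠ 0 := pow_ne_zero _ Complex.I_ne_zero
  field_simp
  ring

/-! Each polynomial has the form (1 + u) A(x) + (1 - u) B(x) with u = y + z, where B(x) = xⁿ A(1/x)
and |B| < |A| for |x| > 1. Jensen's formula in x gives log max(|1 + u|, |1 - u|) whatever the pair
is (`IsInnerPair.circleAverage_eq`), so the three measures coincide.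

Up to a uniformly distributed phase, u is 2 cos s, and symmetry leaves the integral of ½ log(1 + c²
+ 2c cos t) with c = 2 cos s over 0 ≤ s, t ≤ π/2. Scale c by σ = x/(1 - x²), which runs from 0 to 1
as x runs from 0 to the inverse golden ratio p, and differentiate in x. The t-integral becomes an
arctangent (`integral_poisson_quarter`), and the s-integral of that arctangent is Li₂(x) - Li₂(-x)
(`integral_arctan_cos`).

What remains is the integral of (Li₂(x) - Li₂(-x)) d log σ over [0, p]. Integration by parts gives
trilogarithms, which Landen's identity at p² and the duplication formula evaluate to 7/5 ζ(3)
(`oddPrimitive_inv_goldenRatio`). -/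

/-- The real polylogarithm `∑ xⁿ / nᵏ`, `n ≥ 1`. -/
noncomputable def realPolylog (k : ℕ) (x : ℝ) : ℝ := ∑' n : ℕ, x ^ (n + 1) / ((n : ℝ) + 1) ^ k

/-! ### Polylogarithm series and Landen's identities. -/

namespace realPolylog

open Real Set Filter Topology

lemma summable_bound {k : ℕ} (hk : 2 ≤ k) : Summable fun n : ℕ => 1 / ((n : ℝ) + 1) ^ k := by
  have h := (summable_nat_add_iff 1).2 (Real.summable_one_div_nat_pow.2 (show 1 < k by omega))
  simpa using h

lemma norm_term_le (k : ℕ) {x : ℝ} (hx : x ∈ Icc (-1 : ℝ) 1) (n : ℕ) :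
    ‖x ^ (n + 1) / ((n : ℝ) + 1) ^ k‖ ≤ 1 / ((n : ℝ) + 1) ^ k := by
  rw [norm_div, norm_pow, Real.norm_eq_abs, Real.norm_of_nonneg (by positivity)]
  gcongr
  exact pow_le_one₀ (abs_nonneg _) (abs_le.2 hx)

lemma hasSum {k : ℕ} (hk : 2 ≤ k) {x : ℝ} (hx : x ∈ Icc (-1 : ℝ) 1) :
    HasSum (fun n : ℕ => x ^ (n + 1) / ((n : ℝ) + 1) ^ k) (realPolylog k x) :=
  (Summable.of_norm_bounded (summable_bound hk) (norm_term_le k hx)).hasSum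

lemma continuousOn {k : ℕ} (hk : 2 ≤ k) : ContinuousOn (realPolylog k) (Icc (-1) 1) :=
  continuousOn_tsum (fun n => by fun_prop) (summable_bound hk) fun n _ hx => norm_term_le k hx n

lemma zero_right (k : ℕ) : realPolylog k 0 = 0 := by simp [realPolylog]

lemma one_left {x : ℝ} (hx : |x| < 1) : realPolylog 1 x = -log (1 - x) := by
  simpa [realPolylog] using (hasSum_pow_div_log_of_abs_lt_one hx).tsum_eq

lemma hasDerivAt (k : ℕ) {x : ℝ} (hx : |x| < 1) (h0 : x ≠ 0) :
    HasDerivAt (realPolylog (k + 1)) (realPolylog k x / x) x := by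
  obtain ⟨r, hr, hr1⟩ := exists_between hx
  have hr0 : 0 ≤ r := (abs_nonneg x).trans hr.le
  have key : HasDerivAt (fun z : ℝ => ∑' n : ℕ, z ^ (n + 1) / ((n : ℝ) + 1) ^ (k + 1))
      (∑' n : ℕ, x ^ n / ((n : ℝ) + 1) ^ k) x := by
    refine hasDerivAt_tsum_of_isPreconnected (t := Ioo (-r) r) (y₀ := (0 : ℝ))
      (g := fun (n : ℕ) (z : ℝ) => z ^ (n + 1) / ((n : ℝ) + 1) ^ (k + 1))
      (g' := fun (n : ℕ) (z : ℝ) => z ^ n / ((n : ℝ) + 1) ^ k) (u := fun n : ℕ => r ^ n)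
      (summable_geometric_of_lt_one hr0 hr1) isOpen_Ioo isPreconnected_Ioo ?_ ?_ ?_ ?_ ?_
    · intro n y _
      have h := ((hasDerivAt_id y).pow (n + 1)).div_const (((n : ℝ) + 1) ^ (k + 1))
      refine h.congr_deriv ?_
      have : (n : ℝ) + 1 ≠ 0 := by positivity
      simp only [id, Nat.add_sub_cancel]
      push_cast
      field_simp
      ring
    · intro n y hy
      rw [norm_div, norm_pow, Real.norm_eq_abs, Real.norm_of_nonneg (by positivity)]
      calc |y| ^ n / ((n : ℝ) + 1) ^ k ≤ |y| ^ n / 1 := by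
            gcongr
            exact one_le_pow₀ (by linarith [Nat.cast_nonneg (α := ℝ) n])
        _ ≤ r ^ n := by
            rw [div_one]
            gcongr
            exact (abs_lt.2 hy).le
    · exact ⟨by linarith [abs_nonneg x], by linarith [abs_nonneg x]⟩
    · simp
    · exact abs_lt.1 hr
  refine key.congr_deriv ?_
  unfold realPolylog
  rw [← tsum_div_const]
  refine tsum_congr fun n => ?_
  field_simp
  ring

lemma hasDerivAt_two {x : ℝ} (hx : |x| < 1) (h0 : x ≠ 0) :
    HasDerivAt (realPolylog 2) (-log (1 - x) / x) x := by
  simpa only [one_left hx] using hasDerivAt 1 hx h0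

lemma hasDerivAt_three {x : ℝ} (hx : |x| < 1) (h0 : x ≠ 0) :
    HasDerivAt (realPolylog 3) (realPolylog 2 x / x) x := hasDerivAt 2 hx h0

/-- The odd part of the polylogarithm. -/
lemma hasSum_sub_neg {k : ℕ} (hk : 2 ≤ k) {x : ℝ} (hx : x ∈ Icc (-1 : ℝ) 1) :
    HasSum (fun n : ℕ => 2 * (x ^ (2 * n + 1) / (2 * (n : ℝ) + 1) ^ k))
      (realPolylog k x - realPolylog k (-x)) := by
  have h := (hasSum hk hx).sub (hasSum hk (x := -x) ⟨by linarith [hx.2], by linarith [hx.1]⟩)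
  -- Index n carries exponent n + 1, so the surviving odd powers sit at even indices.
  have hinj : Function.Injective fun n : ℕ => 2 * n := fun a b h => by simpa using h
  rw [← hinj.hasSum_iff] at h
  · convert! h using 2 with n
    simp only [Function.comp_apply]
    rw [Odd.neg_pow ⟨n, rfl⟩]
    push_cast
    ring
  · intro m hm
    have hodd : Odd m := by
      rw [← Nat.not_even_iff_odd]
      rintro ⟨j, rfl⟩
      exact hm ⟨j, by ring⟩
    rw [(hodd.add_one).neg_pow, sub_self]

/-- Duplication formula: odd powers cancel, and each even power x^(2m)/(2m)ᵏ is counted twice. -/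
lemma add_neg {k : ℕ} (hk : 2 ≤ k) {x : ℝ} (hx : x ∈ Icc (-1 : ℝ) 1) :
    realPolylog k x + realPolylog k (-x) = 2 / 2 ^ k * realPolylog k (x ^ 2) := by
  have h := (hasSum hk hx).add (hasSum hk (x := -x) ⟨by linarith [hx.2], by linarith [hx.1]⟩)
  have hinj : Function.Injective fun n : ℕ => 2 * n + 1 := fun a b h => by simpa using h
  rw [← hinj.hasSum_iff] at h
  · have hx2 : x ^ 2 ∈ Icc (-1 : ℝ) 1 :=
      ⟨by nlinarith [sq_nonneg x], by nlinarith [hx.1, hx.2]⟩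
    refine h.unique ?_
    convert! (hasSum hk hx2).mul_left (2 / 2 ^ k) using 2 with n
    simp only [Function.comp_apply]
    have e : Even (2 * n + 1 + 1) := ⟨n + 1, by ring⟩
    rw [e.neg_pow, ← pow_mul]
    push_cast
    rw [show 2 * (n : ℝ) + 1 + 1 = 2 * (n + 1) by ring, mul_pow]
    field_simp
    ring
  · intro m hm
    have hev : Even m := by
      rw [← Nat.not_odd_iff_even]
      rintro ⟨j, rfl⟩
      exact hm ⟨j, rfl⟩
    rw [(hev.add_one).neg_pow]
    ring

lemma three_one : ((realPolylog 3 1 : ℝ) : ℂ) = riemannZeta 3 := by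
  have h := zeta_nat_eq_tsum_of_gt_one (k := 3) (by norm_num)
  have hs : Summable fun n : ℕ => 1 / (n : ℝ) ^ 3 :=
    Real.summable_one_div_nat_pow.2 (by norm_num)
  have h2 : ((∑' n : ℕ, 1 / (n : ℝ) ^ 3 : ℝ) : ℂ) = riemannZeta 3 := by
    rw [Complex.ofReal_tsum]
    push_cast
    exact_mod_cast h.symm
  rw [← h2, hs.tsum_eq_zero_add]
  simp [realPolylog]

/-- An antiderivative of `log² (1 - x) / x`. -/
noncomputable def logSqSub (x : ℝ) : ℝ :=
  log x * log (1 - x) ^ 2 + 2 * log (1 - x) * realPolylog 2 (1 - x) - 2 * realPolylog 3 (1 - x)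

/-- An antiderivative of `log² (1 + x) / x`. -/
noncomputable def logSqAdd (x : ℝ) : ℝ :=
  log x * log (1 + x) ^ 2 - 2 / 3 * log (1 + x) ^ 3
    - 2 * log (1 + x) * realPolylog 2 (1 + x)⁻¹ - 2 * realPolylog 3 (1 + x)⁻¹

lemma hasDerivAt_logSqSub {x : ℝ} (h0 : 0 < x) (h1 : x < 1) :
    HasDerivAt logSqSub (log (1 - x) ^ 2 / x) x := by
  have hx : |1 - x| < 1 := abs_lt.2 ⟨by linarith, by linarith⟩
  have hne : 1 - x ≠ 0 := by linarith
  have d1 : HasDerivAt (fun y : ℝ => 1 - y) (-1) x := by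
    simpa using (hasDerivAt_id x).const_sub 1
  have dl := d1.log hne
  have d2 := (hasDerivAt_two hx hne).comp x d1
  have d3 := (hasDerivAt_three hx hne).comp x d1
  have h := (((hasDerivAt_log h0.ne').mul (dl.pow 2)).add ((dl.const_mul 2).mul d2)).sub
    (d3.const_mul 2)
  refine h.congr_deriv ?_
  simp only [Function.comp_apply, sub_sub_cancel, Pi.pow_apply]
  field_simp
  push_cast
  ring

/-- The argument (1 + x)⁻¹ replaces 1 + x, which lies outside the disc of convergence; the cubic
logarithm compensates for this inversion. -/
lemma hasDerivAt_logSqAdd {x : ℝ} (h0 : 0 < x) :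
    HasDerivAt logSqAdd (log (1 + x) ^ 2 / x) x := by
  have hp : 0 < 1 + x := by linarith
  have hne : 1 + x ≠ 0 := hp.ne'
  have hx : |(1 + x)⁻¹| < 1 := by
    rw [abs_of_pos (by positivity)]
    exact inv_lt_one_of_one_lt₀ (by linarith)
  have d1 : HasDerivAt (fun y : ℝ => 1 + y) 1 x := by
    simpa using (hasDerivAt_id x).const_add 1
  have dl := d1.log hne
  have di := d1.inv hne
  have d2 := (hasDerivAt_two hx (inv_ne_zero hne)).comp x di
  have d3 := (hasDerivAt_three hx (inv_ne_zero hne)).comp x di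
  have h := ((((hasDerivAt_log h0.ne').mul (dl.pow 2)).sub ((dl.pow 3).const_mul (2 / 3))).sub
    ((dl.const_mul 2).mul d2)).sub (d3.const_mul 2)
  have hl : log (1 - (1 + x)⁻¹) = log x - log (1 + x) := by
    rw [← log_div h0.ne' hne]
    congr 1
    field_simp
    ring
  refine h.congr_deriv ?_
  simp only [Function.comp_apply, hl, Pi.pow_apply, Pi.inv_apply]
  field_simp
  push_cast
  ring

/-- Writing h x = x · `dslope h 0 x` turns the product into (x log x) · `dslope h 0 x` · h x, which
is continuous at 0. This admits the endpoint 0 for both primitives. -/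
lemma continuousOn_log_mul_sq {h : ℝ → ℝ} (hc : ContinuousOn h (Ioo (-1) 1))
    (hd : DifferentiableAt ℝ h 0) (h0 : h 0 = 0) :
    ContinuousOn (fun x => log x * h x ^ 2) (Ioo (-1) 1) := by
  have hs : ContinuousOn (dslope h 0) (Ioo (-1) 1) :=
    (continuousOn_dslope (Ioo_mem_nhds (by norm_num) (by norm_num))).2 ⟨hc, hd⟩
  have := (continuous_mul_log.continuousOn.mul hs).mul hc
  refine this.congr fun x _ => ?_
  have e : x * dslope h 0 x = h x := by
    simpa [h0] using sub_smul_dslope h 0 x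
  simp only [Pi.mul_apply]
  linear_combination (-(log x * h x)) * e

lemma continuousOn_logSqSub : ContinuousOn logSqSub (Ico 0 1) := by
  have hl : ContinuousOn (fun x : ℝ => log (1 - x)) (Ioo (-1) 1) :=
    ContinuousOn.log (by fun_prop) fun x hx => by linarith [hx.2]
  have hd : DifferentiableAt ℝ (fun x : ℝ => log (1 - x)) 0 := by
    refine DifferentiableAt.log (by fun_prop) (by norm_num)
  have hsub : Ico (0 : ℝ) 1 ⊆ Ioo (-1) 1 := fun x hx => ⟨by linarith [hx.1], hx.2⟩
  have hm : MapsTo (fun x : ℝ => 1 - x) (Ico 0 1) (Icc (-1) 1) :=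
    fun x hx => ⟨by linarith [hx.2], by linarith [hx.1]⟩
  have h1 := (continuousOn_log_mul_sq hl hd (by simp)).mono hsub
  have h2 := (continuousOn le_rfl).comp (f := fun x : ℝ => 1 - x) (by fun_prop) hm
  have h3 := (continuousOn (show 2 ≤ 3 by norm_num)).comp (f := fun x : ℝ => 1 - x)
    (by fun_prop) hm
  exact (h1.add ((continuousOn_const.mul (hl.mono hsub)).mul h2)).sub (continuousOn_const.mul h3)

lemma continuousOn_logSqAdd : ContinuousOn logSqAdd (Ico 0 1) := by
  have hl : ContinuousOn (fun x : ℝ => log (1 + x)) (Ioo (-1) 1) :=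
    ContinuousOn.log (by fun_prop) fun x hx => by linarith [hx.1]
  have hd : DifferentiableAt ℝ (fun x : ℝ => log (1 + x)) 0 := by
    refine DifferentiableAt.log (by fun_prop) (by norm_num)
  have hsub : Ico (0 : ℝ) 1 ⊆ Ioo (-1) 1 := fun x hx => ⟨by linarith [hx.1], hx.2⟩
  have hm : MapsTo (fun x : ℝ => (1 + x)⁻¹) (Ico 0 1) (Icc (-1) 1) := fun x hx => by
    have h : (0 : ℝ) < 1 + x := by linarith [hx.1]
    exact ⟨by linarith [inv_pos.2 h], inv_le_one_of_one_le₀ (by linarith [hx.1])⟩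
  have hi : ContinuousOn (fun x : ℝ => (1 + x)⁻¹) (Ico 0 1) :=
    ContinuousOn.inv₀ (by fun_prop) fun x hx => by linarith [hx.1]
  have h1 := (continuousOn_log_mul_sq hl hd (by simp)).mono hsub
  have h2 := (continuousOn le_rfl).comp hi hm
  have h3 := (continuousOn (show 2 ≤ 3 by norm_num)).comp hi hm
  exact ((h1.sub (continuousOn_const.mul ((hl.mono hsub).pow 3))).sub
    ((continuousOn_const.mul (hl.mono hsub)).mul h2)).sub (continuousOn_const.mul h3)

lemma logSqSub_zero : logSqSub 0 = -2 * realPolylog 3 1 := by simp [logSqSub]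

lemma logSqAdd_zero : logSqAdd 0 = -2 * realPolylog 3 1 := by simp [logSqAdd]

/-- A function that is continuous on `[0, x]` and has zero derivative on `(0, x)` takes the same
value at both ends. -/
lemma eq_of_hasDerivAt_zero {f : ℝ → ℝ} {x : ℝ} (h0 : 0 ≤ x) (hc : ContinuousOn f (Icc 0 x))
    (hd : ∀ y ∈ Ioo 0 x, HasDerivAt f 0 y) : f x = f 0 := by
  rcases h0.eq_or_lt with rfl | h
  · rfl
  obtain ⟨c, -, hs⟩ := exists_hasDerivAt_eq_slope f (fun _ => 0) h hc hd
  rw [eq_comm, div_eq_zero_iff] at hs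
  rcases hs with hs | hs <;> linarith

/-- The bound 1/2 is exactly what keeps Landen's argument y/(y - 1) above -1, within reach of the
series. -/
lemma mapsTo_div_sub_one {x : ℝ} (h1 : x < 1 / 2) :
    MapsTo (fun y : ℝ => y / (y - 1)) (Icc 0 x) (Icc (-1) 1) := fun y hy => by
  have h : y - 1 < 0 := by linarith [hy.2]
  constructor
  · rw [le_div_iff_of_neg h]
    linarith [hy.2]
  · rw [div_le_iff_of_neg h]
    linarith [hy.2]

lemma continuousOn_div_sub_one {x : ℝ} (h1 : x < 1 / 2) :
    ContinuousOn (fun y : ℝ => y / (y - 1)) (Icc 0 x) :=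
  ContinuousOn.div (by fun_prop) (by fun_prop) fun y hy => by linarith [hy.2]

lemma abs_div_sub_one_lt {y : ℝ} (h0 : 0 < y) (h1 : y < 1 / 2) : |y / (y - 1)| < 1 := by
  have h : y - 1 < 0 := by linarith
  rw [abs_div, abs_of_pos h0, abs_of_neg h, div_lt_one (by linarith)]
  linarith

lemma hasDerivAt_div_sub_one {y : ℝ} (h1 : y < 1) :
    HasDerivAt (fun z : ℝ => z / (z - 1)) (-1 / (1 - y) ^ 2) y := by
  have h : y - 1 ≠ 0 := by linarith
  have h' : 1 - y ≠ 0 := by linarith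
  refine ((hasDerivAt_id y).div ((hasDerivAt_id y).sub_const 1) h).congr_deriv ?_
  simp only [id]
  rw [← neg_sub y 1, neg_sq]
  ring

/-- Landen's identity for the dilogarithm. -/
lemma landen_two {x : ℝ} (h0 : 0 ≤ x) (h1 : x < 1 / 2) :
    realPolylog 2 x + realPolylog 2 (x / (x - 1)) = -(log (1 - x) ^ 2 / 2) := by
  have key := eq_of_hasDerivAt_zero
    (f := fun y => realPolylog 2 y + realPolylog 2 (y / (y - 1)) + log (1 - y) ^ 2 / 2) h0 ?_ ?_
  · simp only [zero_right, zero_div, sub_zero, log_one] at key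
    linarith
  · have c1 : ContinuousOn (realPolylog 2) (Icc 0 x) :=
      (continuousOn le_rfl).mono fun y hy => ⟨by linarith [hy.1], by linarith [hy.2]⟩
    have c2 := (continuousOn le_rfl).comp (continuousOn_div_sub_one h1) (mapsTo_div_sub_one h1)
    have c3 : ContinuousOn (fun y : ℝ => log (1 - y)) (Icc 0 x) :=
      ContinuousOn.log (by fun_prop) fun y hy => by linarith [hy.2]
    exact (c1.add c2).add ((c3.pow 2).div_const 2)
  · intro y hy
    have y0 : 0 < y := hy.1
    have y1 : y < 1 / 2 := hy.2.trans h1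
    have hne : y - 1 ≠ 0 := by linarith
    have hne' : 1 - y ≠ 0 := by linarith
    have d1 := hasDerivAt_two (abs_lt.2 ⟨by linarith, by linarith⟩) y0.ne'
    have d2 := (hasDerivAt_two (abs_div_sub_one_lt y0 y1) (div_ne_zero y0.ne' hne)).comp y
      (hasDerivAt_div_sub_one (by linarith))
    have dl := (((hasDerivAt_id y).const_sub 1).log hne').pow 2
    have hl : log (1 - y / (y - 1)) = -log (1 - y) := by
      rw [← log_inv]
      congr 1
      field_simp
      ring
    refine ((d1.add d2).add (dl.div_const 2)).congr_deriv ?_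
    simp only [id, hl]
    field_simp
    push_cast
    ring

/-- Landen's identity for the trilogarithm. -/
lemma landen_three {x : ℝ} (h0 : 0 ≤ x) (h1 : x < 1 / 2) :
    realPolylog 3 x + realPolylog 3 (x / (x - 1)) = logSqSub x / 2 + realPolylog 3 1
      + log (1 - x) ^ 3 / 6 + log (1 - x) * realPolylog 2 x := by
  have key := eq_of_hasDerivAt_zero
    (f := fun y => realPolylog 3 y + realPolylog 3 (y / (y - 1)) - logSqSub y / 2
      - log (1 - y) ^ 3 / 6 - log (1 - y) * realPolylog 2 y) h0 ?_ ?_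
  · simp only [zero_right, zero_div, sub_zero, log_one, logSqSub_zero] at key
    linarith
  · have hsub : Icc 0 x ⊆ Icc (-1) 1 := fun y hy => ⟨by linarith [hy.1], by linarith [hy.2]⟩
    have c0 : ContinuousOn (realPolylog 2) (Icc 0 x) := (continuousOn le_rfl).mono hsub
    have c1 : ContinuousOn (realPolylog 3) (Icc 0 x) := (continuousOn (by norm_num)).mono hsub
    have c2 := (continuousOn (show 2 ≤ 3 by norm_num)).comp (continuousOn_div_sub_one h1)
      (mapsTo_div_sub_one h1)
    have c3 : ContinuousOn (fun y : ℝ => log (1 - y)) (Icc 0 x) :=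
      ContinuousOn.log (by fun_prop) fun y hy => by linarith [hy.2]
    have c4 : ContinuousOn logSqSub (Icc 0 x) :=
      continuousOn_logSqSub.mono fun y hy => ⟨hy.1, by linarith [hy.2]⟩
    exact (((c1.add c2).sub (c4.div_const 2)).sub ((c3.pow 3).div_const 6)).sub (c3.mul c0)
  · intro y hy
    have y0 : 0 < y := hy.1
    have y1 : y < 1 / 2 := hy.2.trans h1
    have hne : y - 1 ≠ 0 := by linarith
    have hne' : 1 - y ≠ 0 := by linarith
    have hy1 : |y| < 1 := abs_lt.2 ⟨by linarith, by linarith⟩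
    have d0 := hasDerivAt_two hy1 y0.ne'
    have d1 := hasDerivAt_three hy1 y0.ne'
    have d2 := (hasDerivAt_three (abs_div_sub_one_lt y0 y1) (div_ne_zero y0.ne' hne)).comp y
      (hasDerivAt_div_sub_one (by linarith))
    have dl := ((hasDerivAt_id y).const_sub 1).log hne'
    have d4 := hasDerivAt_logSqSub y0 (by linarith)
    -- Landen's dilogarithm identity removes the only term with a transformed argument from the
    -- derivative.
    have hL : realPolylog 2 (y / (y - 1)) = -(log (1 - y) ^ 2 / 2) - realPolylog 2 y := by
      linarith [landen_two y0.le y1]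
    refine ((((d1.add d2).sub (d4.div_const 2)).sub ((dl.pow 3).div_const 6)).sub
      (dl.mul d0)).congr_deriv ?_
    simp only [id, hL]
    field_simp
    push_cast
    ring

end realPolylog

/-! ### The odd dilogarithm integral and the golden ratio. -/

namespace realPolylog

open Real Set Filter Topology

lemma sub_neg_nonneg {k : ℕ} (hk : 2 ≤ k) {x : ℝ} (h0 : 0 ≤ x) (h1 : x ≤ 1) :
    0 ≤ realPolylog k x - realPolylog k (-x) :=
  (hasSum_sub_neg hk ⟨by linarith, h1⟩).nonneg fun n => by positivity

/-- An antiderivative of `(Li₂ x - Li₂ (-x)) (1 + x²) / (x (1 - x²))`. -/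
noncomputable def oddPrimitive (x : ℝ) : ℝ :=
  (realPolylog 3 x - realPolylog 3 (-x))
    - (realPolylog 2 x - realPolylog 2 (-x)) * (log (1 - x) + log (1 + x))
    + logSqAdd x - logSqSub x

lemma continuousOn_oddPrimitive : ContinuousOn oddPrimitive (Ico 0 1) := by
  have hm : MapsTo (fun x : ℝ => x) (Ico 0 1) (Icc (-1) 1) :=
    fun x hx => ⟨by linarith [hx.1], hx.2.le⟩
  have hn : MapsTo (fun x : ℝ => -x) (Ico 0 1) (Icc (-1) 1) :=
    fun x hx => ⟨by linarith [hx.2], by linarith [hx.1]⟩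
  have l1 : ContinuousOn (fun x : ℝ => log (1 - x)) (Ico 0 1) :=
    ContinuousOn.log (by fun_prop) fun x hx => by linarith [hx.2]
  have l2 : ContinuousOn (fun x : ℝ => log (1 + x)) (Ico 0 1) :=
    ContinuousOn.log (by fun_prop) fun x hx => by linarith [hx.1]
  have h (k : ℕ) (hk : 2 ≤ k) := ((continuousOn hk).comp continuousOn_id hm).sub
    ((continuousOn hk).comp continuousOn_neg hn)
  exact (((h 3 (by norm_num)).sub ((h 2 le_rfl).mul (l1.add l2))).add
    continuousOn_logSqAdd).sub continuousOn_logSqSub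

lemma oddPrimitive_zero : oddPrimitive 0 = 0 := by
  simp [oddPrimitive, logSqAdd_zero, logSqSub_zero]

/-- Integration by parts: the weight is the derivative of log x - log(1 - x²), and differentiating
Li₂(x) - Li₂(-x) against log(1 - x²) leaves (log²(1 + x) - log²(1 - x))/x. -/
lemma hasDerivAt_oddPrimitive {x : ℝ} (h0 : 0 < x) (h1 : x < 1) :
    HasDerivAt oddPrimitive
      ((realPolylog 2 x - realPolylog 2 (-x)) * ((1 + x ^ 2) / (x * (1 - x ^ 2)))) x := by
  have hx : |x| < 1 := abs_lt.2 ⟨by linarith, h1⟩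
  have hx' : |-x| < 1 := by rwa [abs_neg]
  have n1 : 1 - x ≠ 0 := by linarith
  have n2 : 1 + x ≠ 0 := by linarith
  have n3 : 1 - x ^ 2 ≠ 0 := by
    rw [show 1 - x ^ 2 = (1 - x) * (1 + x) by ring]
    exact mul_ne_zero n1 n2
  have dn := hasDerivAt_neg x
  have a2 := (hasDerivAt_two hx h0.ne').sub
    ((hasDerivAt_two hx' (neg_ne_zero.2 h0.ne')).comp x dn)
  have a3 := (hasDerivAt_three hx h0.ne').sub
    ((hasDerivAt_three hx' (neg_ne_zero.2 h0.ne')).comp x dn)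
  have l1 := ((hasDerivAt_id x).const_sub 1).log n1
  have l2 := ((hasDerivAt_id x).const_add 1).log n2
  refine (((a3.sub (a2.mul (l1.add l2))).add (hasDerivAt_logSqAdd h0)).sub
    (hasDerivAt_logSqSub h0 h1)).congr_deriv ?_
  simp only [id, Pi.add_apply, Pi.sub_apply, Function.comp_apply, sub_neg_eq_add]
  rw [show 1 - x ^ 2 = (1 - x) * (1 + x) by ring]
  field_simp
  ring

/-- The value of the primitive at the inverse `p` of the golden ratio. -/
lemma oddPrimitive_inv_goldenRatio {p : ℝ} (h0 : 0 < p) (hp : p ^ 2 + p = 1) :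
    oddPrimitive p = 7 / 5 * realPolylog 3 1 := by
  have h1 : p < 1 := by nlinarith
  have hh : p ^ 2 < 1 / 2 := by nlinarith
  -- Since p² + p = 1, all polylogarithm arguments collapse to p, -p and p².
  have e1 : 1 - p = p ^ 2 := by linarith
  have e2 : 1 + p = p⁻¹ := by
    refine eq_inv_of_mul_eq_one_left ?_
    linarith
  have e3 : 1 - p ^ 2 = p := by linarith
  have e4 : p ^ 2 / (p ^ 2 - 1) = -p := by
    rw [div_eq_iff (by linarith)]
    nlinarith
  have hmem : p ∈ Icc (-1 : ℝ) 1 := ⟨by linarith, h1.le⟩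
  have t2 := add_neg (k := 2) le_rfl hmem
  have t3 := add_neg (k := 3) (by norm_num) hmem
  have L2 := landen_two (sq_nonneg p) hh
  have L3 := landen_three (sq_nonneg p) hh
  simp only [logSqSub, e3, e4, log_pow] at L2 L3
  simp only [oddPrimitive, logSqAdd, logSqSub, e1, e2, log_pow, log_inv, inv_inv]
  push_cast at *
  generalize realPolylog 3 1 = z at *
  generalize realPolylog 3 p = a at *
  generalize realPolylog 3 (-p) = b at *
  generalize realPolylog 3 (p ^ 2) = c at *
  generalize realPolylog 2 p = d at *
  generalize realPolylog 2 (-p) = e at *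
  generalize realPolylog 2 (p ^ 2) = f at *
  generalize log p = l at *
  have hb : b = 2 / 8 * c - a := by linarith
  have he : e = 2 / 4 * f - d := by linarith
  subst hb he
  have hd : d = 3 / 2 * f + l ^ 2 / 2 := by linarith
  subst hd
  -- Modulo lower terms, `L3` reads 5/4 Li₃(p²) = ζ(3), while the primitive is 7/4 Li₃(p²).
  linear_combination (7 / 5) * L3

/-- The odd dilogarithm integrated up to the inverse of the golden ratio. -/
theorem integral_odd_two {p : ℝ} (h0 : 0 < p) (hp : p ^ 2 + p = 1) :
    ∫ x in 0..p, (realPolylog 2 x - realPolylog 2 (-x)) * ((1 + x ^ 2) / (x * (1 - x ^ 2)))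
      = 7 / 5 * realPolylog 3 1 := by
  have h1 : p < 1 := by nlinarith
  have hc : ContinuousOn oddPrimitive (Icc 0 p) :=
    continuousOn_oddPrimitive.mono fun x hx => ⟨hx.1, hx.2.trans_lt h1⟩
  have hd : ∀ x ∈ Ioo 0 p, HasDerivAt oddPrimitive
      ((realPolylog 2 x - realPolylog 2 (-x)) * ((1 + x ^ 2) / (x * (1 - x ^ 2)))) x :=
    fun x hx => hasDerivAt_oddPrimitive hx.1 (hx.2.trans h1)
  rw [intervalIntegral.integral_eq_sub_of_hasDerivAt_of_le h0.le hc hd,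
    oddPrimitive_zero, sub_zero, oddPrimitive_inv_goldenRatio h0 hp]
  -- Integrability is free because the integrand is a nonnegative derivative of a continuous
  -- function.
  refine intervalIntegral.intervalIntegrable_deriv_of_nonneg (g := oddPrimitive)
    (by rwa [uIcc_of_le h0.le]) ?_ ?_
  · rw [min_eq_left h0.le, max_eq_right h0.le]
    exact hd
  · rw [min_eq_left h0.le, max_eq_right h0.le]
    intro x hx
    have x1 := hx.2.trans h1
    have x0 : 0 < x := hx.1
    have : 0 < 1 - x ^ 2 := by nlinarith
    exact mul_nonneg (sub_neg_nonneg le_rfl x0.le x1.le) (by positivity)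

end realPolylog

/-! ### Arctangent integrals and the reduction to the odd dilogarithm. -/

section ArctanIntegrals

open Real Set MeasureTheory

/-- Exchange of two interval integrals of a function continuous on the closed rectangle. -/
lemma intervalIntegral_swap_of_continuousOn {F : ℝ → ℝ → ℝ} {a b c d : ℝ} (hab : a ≤ b)
    (hcd : c ≤ d) (hF : ContinuousOn (Function.uncurry F) (Icc a b ×ˢ Icc c d)) :
    ∫ x in a..b, ∫ y in c..d, F x y = ∫ y in c..d, ∫ x in a..b, F x y := by
  refine intervalIntegral_intervalIntegral_swap ?_
  rw [uIoc_of_le hab, uIoc_of_le hcd]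
  exact (hF.integrableOn_compact (isCompact_Icc.prod isCompact_Icc)).mono_set
    (prod_mono Ioc_subset_Icc_self Ioc_subset_Icc_self)

/-- Twice the real part is the argument of (1 + iz)/(1 - iz). Scaling by |1 - iz|² gives 1 - |z|² +
2i Re z, which lies in the right half-plane. -/
lemma re_arctan_eq {z : ℂ} (hz : ‖z‖ < 1) :
    2 * (Complex.arctan z).re = arctan (2 * z.re / (1 - ‖z‖ ^ 2)) := by
  have hpos : 0 < 1 - ‖z‖ ^ 2 := by nlinarith [norm_nonneg z]
  have hne : 1 - z * Complex.I ≠ 0 := by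
    intro h
    have h2 : ‖z * Complex.I‖ = 1 := by rw [← sub_eq_zero.1 h]; simp
    simp at h2
    linarith
  set w := (1 + z * Complex.I) / (1 - z * Complex.I) with hw
  have hN : 0 < Complex.normSq (1 - z * Complex.I) := Complex.normSq_pos.2 hne
  set v : ℂ := ⟨1 - ‖z‖ ^ 2, 2 * z.re⟩ with hv
  have hvw : (Complex.normSq (1 - z * Complex.I) : ℂ) * w = v := by
    rw [hw, Complex.normSq_eq_conj_mul_self, mul_assoc, mul_div_cancel₀ _ hne]
    rw [hv, ← Complex.normSq_eq_norm_sq, Complex.normSq_apply]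
    apply Complex.ext <;> simp <;> ring
  have harg : w.arg = v.arg := by rw [← hvw, Complex.arg_real_mul _ hN]
  have hb : |v.arg| < π / 2 := Complex.abs_arg_lt_pi_div_two_iff.2 (Or.inl hpos)
  have hre : (Complex.arctan z).re = w.arg / 2 := by
    rw [Complex.arctan, ← hw]
    simp [Complex.mul_re, Complex.log_im]
    ring
  rw [hre, harg, mul_div_cancel₀ _ two_ne_zero,
    ← arctan_tan (abs_lt.1 hb).1 (abs_lt.1 hb).2, Complex.tan_arg]

/-- Real part of the arctangent series at z = p e^{it}. -/
lemma hasSum_arctan_cos {p : ℝ} (h0 : 0 ≤ p) (h1 : p < 1) (t : ℝ) :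
    HasSum (fun n : ℕ => 2 * ((-1) ^ n * p ^ (2 * n + 1) / (2 * n + 1)) * cos ((2 * n + 1) * t))
      (arctan (2 * p * cos t / (1 - p ^ 2))) := by
  have hn : ‖(p : ℂ) * Complex.exp (t * Complex.I)‖ = p := by
    rw [norm_mul, Complex.norm_exp_ofReal_mul_I, mul_one, Complex.norm_real, norm_of_nonneg h0]
  have hre : ((p : ℂ) * Complex.exp (t * Complex.I)).re = p * cos t := by
    rw [Complex.re_ofReal_mul, Complex.exp_ofReal_mul_I_re]
  have h := ((Complex.hasSum_re (Complex.hasSum_arctan (hn.trans_lt h1))).mul_left 2)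
  rw [re_arctan_eq (hn.trans_lt h1), hn, hre, ← mul_assoc] at h
  convert! h using 2 with n
  have e : (-1 : ℂ) ^ n * ((p : ℂ) * Complex.exp (t * Complex.I)) ^ (2 * n + 1)
      / ((2 * n + 1 : ℕ) : ℂ) = (((-1) ^ n * p ^ (2 * n + 1) / (2 * n + 1) : ℝ) : ℂ)
        * Complex.exp (((2 * n + 1) * t : ℝ) * Complex.I) := by
    rw [mul_pow, ← Complex.exp_nat_mul]
    push_cast
    ring_nf
  rw [e, Complex.re_ofReal_mul, Complex.exp_ofReal_mul_I_re, mul_assoc]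

lemma integral_cos_odd_mul (n : ℕ) :
    ∫ t in 0..π / 2, cos ((2 * n + 1) * t) = (-1) ^ n / (2 * n + 1) := by
  have hne : (2 * (n : ℝ) + 1) ≠ 0 := by positivity
  rw [intervalIntegral.integral_comp_mul_left _ hne, integral_cos]
  have : sin ((2 * n + 1) * (π / 2)) = (-1) ^ n := by
    rw [show (2 * (n : ℝ) + 1) * (π / 2) = n * π + π / 2 by ring, sin_add_pi_div_two,
      cos_nat_mul_pi]
  rw [this]
  simp
  ring

/-- `∫ arctan (2 p cos t / (1 - p²)) dt` over `[0, π/2]` is the odd dilogarithm of `p`. -/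
theorem integral_arctan_cos {p : ℝ} (h0 : 0 ≤ p) (h1 : p < 1) :
    ∫ t in 0..π / 2, arctan (2 * p * cos t / (1 - p ^ 2))
      = realPolylog 2 p - realPolylog 2 (-p) := by
  have hint : HasSum (fun n : ℕ => ∫ t in 0..π / 2,
      2 * ((-1) ^ n * p ^ (2 * n + 1) / (2 * n + 1)) * cos ((2 * n + 1) * t))
      (∫ t in 0..π / 2, arctan (2 * p * cos t / (1 - p ^ 2))) := by
    refine intervalIntegral.hasSum_integral_of_dominated_convergence
      (fun n _ => 2 * p ^ n) (fun n => by fun_prop) ?_ ?_ ?_ ?_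
    · intro n
      refine Filter.Eventually.of_forall fun t _ => ?_
      have hc := abs_cos_le_one ((2 * n + 1) * t)
      rw [norm_mul, norm_mul, norm_div, norm_mul, norm_pow, norm_pow, norm_neg, norm_one, one_pow,
        one_mul, norm_of_nonneg h0, norm_of_nonneg zero_le_two, norm_eq_abs (cos _),
        norm_of_nonneg (show (0 : ℝ) ≤ 2 * n + 1 by positivity), mul_assoc]
      gcongr
      calc p ^ (2 * n + 1) / (2 * n + 1) * |cos ((2 * n + 1) * t)|
          ≤ p ^ (2 * n + 1) / 1 * 1 := by
            gcongr
            linarith [Nat.cast_nonneg (α := ℝ) n]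
        _ ≤ p ^ n := by
            rw [mul_one, div_one]
            exact pow_le_pow_of_le_one h0 h1.le (by omega)
    · exact Filter.Eventually.of_forall fun t _ =>
        (summable_geometric_of_lt_one h0 h1).mul_left 2
    · exact intervalIntegrable_const
    · exact Filter.Eventually.of_forall fun t _ => hasSum_arctan_cos h0 h1 t
  refine hint.unique ?_
  convert! realPolylog.hasSum_sub_neg (k := 2) le_rfl ⟨by linarith, h1.le⟩ using 2 with n
  rw [intervalIntegral.integral_const_mul, integral_cos_odd_mul]
  have hne : (2 * (n : ℝ) + 1) ≠ 0 := by positivity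
  have h2 : ((-1 : ℝ) ^ n) * (-1) ^ n = 1 := by rw [← mul_pow]; simp
  field_simp
  linear_combination (p ^ (2 * n + 1)) * h2

lemma denom_pos {k t : ℝ} (hk : 0 ≤ k) (ht : t ∈ Icc 0 (π / 2)) :
    0 < 1 + k ^ 2 + 2 * k * cos t := by
  have : 0 ≤ cos t := cos_nonneg_of_mem_Icc ⟨by linarith [ht.1, pi_pos], ht.2⟩
  positivity

/-- `dslope arctan 0` is arctan k / k extended by 1 at 0; it keeps the integrands continuous where
the scale or cos s vanishes. -/
lemma continuous_dslope_arctan : Continuous (dslope arctan 0) := by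
  rw [← continuousOn_univ, continuousOn_dslope Filter.univ_mem]
  exact ⟨continuous_arctan.continuousOn, differentiable_arctan 0⟩

lemma mul_dslope_arctan (k : ℝ) : k * dslope arctan 0 k = arctan k := by
  simpa using sub_smul_dslope arctan 0 k

/-- For k > 0, k times the integrand is the t-derivative of arctan(k sin t/(1 + k cos t)), the
argument of 1 + k e^{it}; its value at π/2 is arctan k. -/
lemma integral_poisson_quarter {k : ℝ} (hk : 0 ≤ k) :
    ∫ t in 0..π / 2, (k + cos t) / (1 + k ^ 2 + 2 * k * cos t) = dslope arctan 0 k := by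
  rcases hk.eq_or_lt with rfl | hk'
  · simp [dslope_same, Real.deriv_arctan]
  have hpi : 0 ≤ π / 2 := by positivity
  have hd : ∀ t ∈ uIcc 0 (π / 2), HasDerivAt (fun t => arctan (k * sin t / (1 + k * cos t)))
      (k * ((k + cos t) / (1 + k ^ 2 + 2 * k * cos t))) t := by
    intro t ht
    rw [uIcc_of_le hpi] at ht
    have hc : 0 ≤ cos t := cos_nonneg_of_mem_Icc ⟨by linarith [ht.1, pi_pos], ht.2⟩
    have hD := (denom_pos hk ht).ne'
    have h1 : 1 + k * cos t ≠ 0 := by positivity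
    have h := (((hasDerivAt_sin t).const_mul k).div
      (((hasDerivAt_cos t).const_mul k).const_add 1) h1).arctan
    refine h.congr_deriv ?_
    have hsc := sin_sq_add_cos_sq t
    have h3 : 1 + (k * sin t / (1 + k * cos t)) ^ 2
        = (1 + k ^ 2 + 2 * k * cos t) / (1 + k * cos t) ^ 2 := by
      field_simp
      linear_combination k ^ 2 * hsc
    simp only [Pi.div_apply]
    rw [h3]
    field_simp
    linear_combination k * hsc
  have hi := intervalIntegral.integral_eq_sub_of_hasDerivAt hd ?_
  · rw [intervalIntegral.integral_const_mul] at hi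
    apply mul_left_cancel₀ hk'.ne'
    rw [hi, mul_dslope_arctan]
    simp
  · refine ContinuousOn.intervalIntegrable ?_
    rw [uIcc_of_le hpi]
    exact continuousOn_const.mul
      (ContinuousOn.div (by fun_prop) (by fun_prop) fun t ht => (denom_pos hk ht).ne')

/-- The derivative of `½ log (1 + (sc)² + 2sc cos t)` along `s = x / (1 - x²)`. -/
lemma hasDerivAt_half_log {c t x : ℝ} (hc : 0 ≤ c) (ht : t ∈ Icc 0 (π / 2)) (h0 : 0 ≤ x)
    (h1 : x < 1) :
    HasDerivAt (fun x => log (1 + (x / (1 - x ^ 2) * c) ^ 2 + 2 * (x / (1 - x ^ 2) * c) * cos t) / 2)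
      ((1 + x ^ 2) / (1 - x ^ 2) ^ 2 * c * ((x / (1 - x ^ 2) * c + cos t)
        / (1 + (x / (1 - x ^ 2) * c) ^ 2 + 2 * (x / (1 - x ^ 2) * c) * cos t))) x := by
  have hx : 0 < 1 - x ^ 2 := by nlinarith
  have hk : 0 ≤ x / (1 - x ^ 2) * c := by positivity
  have hD := (denom_pos hk ht).ne'
  have ds : HasDerivAt (fun x : ℝ => x / (1 - x ^ 2) * c) ((1 + x ^ 2) / (1 - x ^ 2) ^ 2 * c) x := by
    refine (((hasDerivAt_id x).div (((hasDerivAt_id x).pow 2).const_sub 1) hx.ne').mul_const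
      c).congr_deriv ?_
    simp only [id, Pi.pow_apply]
    field_simp
    push_cast
    ring
  refine (((((ds.pow 2).const_add 1).add ((ds.const_mul 2).mul_const (cos t))).log
    hD).div_const 2).congr_deriv ?_
  simp only [Pi.pow_apply, Pi.add_apply]
  generalize x / (1 - x ^ 2) * c = k at *
  field_simp
  push_cast
  ring

/-- The logarithm is the integral of its derivative along the scale x/(1 - x²), which is 0 at x = 0
and 1 at x = p; after exchanging the integrals, the t-integral is explicit. -/
lemma integral_log_quarter {c p : ℝ} (hc : 0 ≤ c) (h0 : 0 < p) (hp : p ^ 2 + p = 1) :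
    ∫ t in 0..π / 2, log (1 + c ^ 2 + 2 * c * cos t) / 2
      = ∫ x in 0..p, (1 + x ^ 2) / (1 - x ^ 2) ^ 2 * c
        * dslope arctan 0 (x / (1 - x ^ 2) * c) := by
  have h1 : p < 1 := by nlinarith
  have hpi : 0 ≤ π / 2 := by positivity
  have hcont : ContinuousOn (Function.uncurry fun t x : ℝ => (1 + x ^ 2) / (1 - x ^ 2) ^ 2 * c
      * ((x / (1 - x ^ 2) * c + cos t)
        / (1 + (x / (1 - x ^ 2) * c) ^ 2 + 2 * (x / (1 - x ^ 2) * c) * cos t)))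
      (Icc 0 (π / 2) ×ˢ Icc 0 p) := by
    have hx : ∀ q ∈ Icc (0 : ℝ) (π / 2) ×ˢ Icc (0 : ℝ) p, 0 < 1 - q.2 ^ 2 := fun q hq => by
      nlinarith [hq.2.1, hq.2.2]
    have hs : ContinuousOn (fun q : ℝ × ℝ => q.2 / (1 - q.2 ^ 2) * c)
        (Icc 0 (π / 2) ×ˢ Icc 0 p) :=
      (ContinuousOn.div (by fun_prop) (by fun_prop) fun q hq => (hx q hq).ne').mul
        continuousOn_const
    have ht : ContinuousOn (fun q : ℝ × ℝ => cos q.1) (Icc 0 (π / 2) ×ˢ Icc 0 p) := by fun_prop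
    refine ContinuousOn.mul (ContinuousOn.mul (ContinuousOn.div (by fun_prop) (by fun_prop)
      fun q hq => pow_ne_zero 2 (hx q hq).ne') continuousOn_const) (ContinuousOn.div (hs.add ht)
      ((continuousOn_const.add (hs.pow 2)).add ((continuousOn_const.mul hs).mul ht))
      fun q hq => (denom_pos ?_ hq.1).ne')
    exact mul_nonneg (div_nonneg hq.2.1 (hx q hq).le) hc
  calc ∫ t in 0..π / 2, log (1 + c ^ 2 + 2 * c * cos t) / 2
      = ∫ t in 0..π / 2, ∫ x in 0..p, (1 + x ^ 2) / (1 - x ^ 2) ^ 2 * c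
          * ((x / (1 - x ^ 2) * c + cos t)
            / (1 + (x / (1 - x ^ 2) * c) ^ 2 + 2 * (x / (1 - x ^ 2) * c) * cos t)) := by
        refine intervalIntegral.integral_congr fun t ht => ?_
        rw [uIcc_of_le hpi] at ht
        have hone : p / (1 - p ^ 2) = 1 := by
          rw [div_eq_one_iff_eq (by nlinarith)]
          linarith
        have := intervalIntegral.integral_eq_sub_of_hasDerivAt (a := 0) (b := p)
          (fun x hx => hasDerivAt_half_log hc ht (by rw [uIcc_of_le h0.le] at hx; exact hx.1)
            (by rw [uIcc_of_le h0.le] at hx; exact hx.2.trans_lt h1)) ?_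
        · simp only [this, hone]
          simp
        · refine ContinuousOn.intervalIntegrable ?_
          rw [uIcc_of_le h0.le]
          exact hcont.comp (f := fun x : ℝ => (t, x)) (by fun_prop) fun x hx => ⟨ht, hx⟩
    _ = ∫ x in 0..p, ∫ t in 0..π / 2, (1 + x ^ 2) / (1 - x ^ 2) ^ 2 * c
          * ((x / (1 - x ^ 2) * c + cos t)
            / (1 + (x / (1 - x ^ 2) * c) ^ 2 + 2 * (x / (1 - x ^ 2) * c) * cos t)) :=
        intervalIntegral_swap_of_continuousOn hpi h0.le hcont
    _ = _ := by
        refine intervalIntegral.integral_congr fun x hx => ?_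
        rw [uIcc_of_le h0.le] at hx
        have : 0 < 1 - x ^ 2 := by nlinarith [hx.1, hx.2]
        simp only [intervalIntegral.integral_const_mul]
        rw [integral_poisson_quarter (mul_nonneg (div_nonneg hx.1 this.le) hc)]

/-- The double integral to which the Mahler measures reduce. -/
theorem integral_integral_log_cos :
    ∫ s in 0..π / 2, ∫ t in 0..π / 2, log (1 + (2 * cos s) ^ 2 + 2 * (2 * cos s) * cos t) / 2
      = 7 / 5 * realPolylog 3 1 := by
  obtain ⟨p, h0, hp⟩ : ∃ p : ℝ, 0 < p ∧ p ^ 2 + p = 1 := by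
    refine ⟨(√5 - 1) / 2, ?_, ?_⟩
    · have : (1 : ℝ) < √5 := by rw [lt_sqrt] <;> norm_num
      linarith
    · have : √5 ^ 2 = 5 := sq_sqrt (by norm_num)
      nlinarith
  have h1 : p < 1 := by nlinarith
  have hpi : 0 ≤ π / 2 := by positivity
  have hx : ∀ x ∈ Icc 0 p, 0 < 1 - x ^ 2 := fun x hx => by nlinarith [hx.1, hx.2]
  rw [← realPolylog.integral_odd_two h0 hp]
  calc _ = ∫ s in 0..π / 2, ∫ x in 0..p, (1 + x ^ 2) / (1 - x ^ 2) ^ 2 * (2 * cos s)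
        * dslope arctan 0 (x / (1 - x ^ 2) * (2 * cos s)) := by
        refine intervalIntegral.integral_congr fun s hs => ?_
        rw [uIcc_of_le hpi] at hs
        have : 0 ≤ cos s := cos_nonneg_of_mem_Icc ⟨by linarith [hs.1], hs.2⟩
        exact integral_log_quarter (by positivity) h0 hp
    _ = ∫ x in 0..p, ∫ s in 0..π / 2, (1 + x ^ 2) / (1 - x ^ 2) ^ 2 * (2 * cos s)
        * dslope arctan 0 (x / (1 - x ^ 2) * (2 * cos s)) := by
        refine intervalIntegral_swap_of_continuousOn hpi h0.le ?_
        have hs : ContinuousOn (fun q : ℝ × ℝ => q.2 / (1 - q.2 ^ 2) * (2 * cos q.1))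
            (Icc 0 (π / 2) ×ˢ Icc 0 p) :=
          (ContinuousOn.div (by fun_prop) (by fun_prop) fun q hq => (hx q.2 hq.2).ne').mul
            (by fun_prop)
        exact ContinuousOn.mul (ContinuousOn.mul (ContinuousOn.div (by fun_prop) (by fun_prop)
          fun q hq => pow_ne_zero 2 (hx q.2 hq.2).ne') (by fun_prop))
          (continuous_dslope_arctan.comp_continuousOn hs)
    _ = _ := by
        -- The integrands differ at x = 0, where the right one divides by zero, so equality is only
        -- used on (0, p].
        refine intervalIntegral.integral_congr_ae (Filter.Eventually.of_forall fun x hxm => ?_)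
        rw [uIoc_of_le h0.le] at hxm
        have x0 : 0 < x := hxm.1
        have hD := hx x ⟨x0.le, hxm.2⟩
        rw [← integral_arctan_cos x0.le (hxm.2.trans_lt h1), mul_comm (intervalIntegral _ _ _ _),
          ← intervalIntegral.integral_const_mul]
        refine intervalIntegral.integral_congr fun s _ => ?_
        rw [show 2 * x * cos s / (1 - x ^ 2) = x / (1 - x ^ 2) * (2 * cos s) by ring,
          ← mul_dslope_arctan]
        field_simp

end ArctanIntegrals

/-! ### Jensen's formula for reciprocal pairs and the Schur–Cohn test. -/

section Jensen

open Real Polynomial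

/-- Polynomials `A`, `B` such that `A` is monic, `B (x) = xⁿ A (1 / x)`, and `A / B` is of modulus
greater than one outside the closed unit disc. -/
structure IsInnerPair (A B : ℂ[X]) : Prop where
  monic : A.Monic
  degree_lt : B.degree < A.degree
  norm_lt : ∀ x : ℂ, 1 < ‖x‖ → ‖B.eval x‖ < ‖A.eval x‖
  reverse : ∃ n : ℕ, ∀ x : ℂ, x ≠ 0 → B.eval x = x ^ n * A.eval x⁻¹

namespace IsInnerPair

variable {A B : ℂ[X]}

/-- A root outside the closed disc would give |αA| = |βB|, against |B| < |A| and |β| ≤ |α|. So only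
the leading coefficient α contributes to the Mahler measure. -/
lemma circleAverage_of_le (h : IsInnerPair A B) {α β : ℂ} (hα : α ≠ 0) (hle : ‖β‖ ≤ ‖α‖) :
    circleAverage (fun x => log ‖α * A.eval x + β * B.eval x‖) 0 1 = log ‖α‖ := by
  have hA : A ≠ 0 := h.monic.ne_zero
  have hdeg : (C β * B).degree < (C α * A).degree := by
    rw [degree_C_mul hα]
    refine lt_of_le_of_lt ?_ h.degree_lt
    rcases eq_or_ne β 0 with rfl | hβ
    · simp
    · rw [degree_C_mul hβ]
  have hlead : (C α * A + C β * B).leadingCoeff = α := by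
    rw [leadingCoeff_add_of_degree_lt' hdeg, leadingCoeff_mul, leadingCoeff_C,
      h.monic.leadingCoeff, mul_one]
  have hm := logMahlerMeasure_eq_log_leadingCoeff_add_sum_log_roots (C α * A + C β * B)
  rw [logMahlerMeasure_def, hlead] at hm
  have hroots : ((C α * A + C β * B).roots.map fun a => log⁺ ‖a‖).sum = 0 := by
    refine Multiset.sum_eq_zero fun y hy => ?_
    obtain ⟨a, ha, rfl⟩ := Multiset.mem_map.1 hy
    have hroot := isRoot_of_mem_roots ha
    rw [posLog_eq_zero_iff, abs_norm]
    by_contra! hlt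
    have hB := h.norm_lt a hlt
    simp only [IsRoot.def, eval_add, eval_mul, eval_C] at hroot
    have hn : ‖α‖ * ‖A.eval a‖ = ‖β‖ * ‖B.eval a‖ := by
      rw [← norm_mul, ← norm_mul, eq_neg_of_add_eq_zero_left hroot, norm_neg]
    have : ‖β‖ * ‖B.eval a‖ ≤ ‖α‖ * ‖B.eval a‖ := by gcongr
    have : ‖α‖ * ‖B.eval a‖ < ‖α‖ * ‖A.eval a‖ :=
      mul_lt_mul_of_pos_left hB (norm_pos_iff.2 hα)
    linarith
  rw [hroots, add_zero] at hm
  simpa using hm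

/-- The substitution x ↦ 1/x exchanges A and B up to a power of x, which has modulus one on the
circle. -/
lemma circleAverage_swap (h : IsInnerPair A B) (α β : ℂ) :
    circleAverage (fun x => log ‖α * A.eval x + β * B.eval x‖) 0 1
      = circleAverage (fun x => log ‖β * A.eval x + α * B.eval x‖) 0 1 := by
  obtain ⟨n, hn⟩ := h.reverse
  rw [← circleAverage_zero_one_congr_inv]
  refine circleAverage_congr_sphere fun x hx => ?_
  have hx1 : ‖x‖ = 1 := by simpa using hx
  have hx0 : x ≠ 0 := by
    rintro rfl
    simp at hx1
  have h1 := hn x hx0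
  have h2 := hn x⁻¹ (inv_ne_zero hx0)
  rw [inv_inv] at h2
  have : β * A.eval x + α * B.eval x = x ^ n * (α * A.eval x⁻¹ + β * B.eval x⁻¹) := by
    rw [h1, h2, inv_pow]
    field_simp
    ring
  simp only [this, norm_mul, norm_pow, hx1, one_pow, one_mul]

/-- Jensen's formula for `α A + β B`. -/
theorem circleAverage_eq (h : IsInnerPair A B) {α β : ℂ} (hne : α ≠ 0 ∨ β ≠ 0) :
    circleAverage (fun x => log ‖α * A.eval x + β * B.eval x‖) 0 1 = log (max ‖α‖ ‖β‖) := by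
  rcases le_total ‖β‖ ‖α‖ with hle | hle
  · rw [max_eq_left hle]
    refine h.circleAverage_of_le ?_ hle
    rintro rfl
    simp_all
  · rw [max_eq_right hle, h.circleAverage_swap]
    refine h.circleAverage_of_le ?_ hle
    rintro rfl
    simp_all

end IsInnerPair

/-- The hyperbolic rotation step of the Schur–Cohn test. -/
lemma norm_lt_norm_of_schur {a b : ℂ} {k : ℝ} (hk : 1 < k ^ 2) (h : ‖k * b - a‖ < ‖k * a - b‖) :
    ‖b‖ < ‖a‖ := by
  rw [← sq_lt_sq₀ (norm_nonneg _) (norm_nonneg _), ← Complex.normSq_eq_norm_sq,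
    ← Complex.normSq_eq_norm_sq] at *
  simp only [Complex.normSq_apply, Complex.sub_re, Complex.sub_im, Complex.re_ofReal_mul,
    Complex.im_ofReal_mul] at *
  -- |ka - b|² - |kb - a|² = (k² - 1)(|a|² - |b|²).
  nlinarith

/-- |ax + b|² - |bx + a|² = (a² - b²)(|x|² - 1). -/
lemma norm_mul_add_lt {x : ℂ} {a b : ℝ} (hab : b ^ 2 < a ^ 2) (hx : 1 < ‖x‖) :
    ‖(b * x + a : ℂ)‖ < ‖(a * x + b : ℂ)‖ := by
  have hx2 : 1 < ‖x‖ ^ 2 := by nlinarith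
  rw [← sq_lt_sq₀ (norm_nonneg _) (norm_nonneg _), ← Complex.normSq_eq_norm_sq,
    ← Complex.normSq_eq_norm_sq] at *
  simp only [Complex.normSq_apply, Complex.add_re, Complex.add_im, Complex.re_ofReal_mul,
    Complex.im_ofReal_mul, Complex.ofReal_re, Complex.ofReal_im] at *
  nlinarith

lemma norm_lt_norm_mul {x a b : ℂ} (hx : 1 < ‖x‖) (h : ‖b‖ < ‖a‖) : ‖b‖ < ‖x * a‖ := by
  rw [norm_mul]
  nlinarith [norm_nonneg b]

/-- Here and in the next two pairs, A and B are half the sum and half the difference of the part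
free of y + z and the coefficient of y + z. -/
lemma isInnerPair_quadratic :
    IsInnerPair (X ^ 2 + C (1 / 2) * X) (C (1 / 2) * X + 1) where
  monic := by monicity!
  degree_lt := by
    have : (X ^ 2 + C (1 / 2) * X : ℂ[X]).degree = 2 := by compute_degree!
    rw [this]
    refine lt_of_le_of_lt (b := 1) (by compute_degree) (by norm_num)
  norm_lt x hx := by
    have h := norm_lt_norm_mul hx (norm_mul_add_lt (a := 1) (b := 1 / 2) (by norm_num) hx)
    convert! h using 2 <;> simp <;> ring
  reverse := ⟨2, fun x hx => by simp; field_simp; ring⟩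

lemma isInnerPair_quartic :
    IsInnerPair (X ^ 4 - X ^ 3 + C (1 / 2) * X ^ 2) (C (1 / 2) * X ^ 2 - X + 1) where
  monic := by monicity!
  degree_lt := by
    have : (X ^ 4 - X ^ 3 + C (1 / 2) * X ^ 2 : ℂ[X]).degree = 4 := by compute_degree!
    rw [this]
    refine lt_of_le_of_lt (b := 2) (by compute_degree) (by norm_num)
  norm_lt x hx := by
    have h := norm_lt_norm_mul hx (norm_mul_add_lt (a := 3 / 2) (b := -1) (by norm_num) hx)
    have h' : ‖1 / 2 * x ^ 2 - x + 1‖ < ‖x ^ 2 - x + 1 / 2‖ := by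
      -- k is the ratio of leading coefficients: kb - a loses its top term and ka - b its constant
      -- term, so a factor x splits off and the degree drops.
      refine norm_lt_norm_of_schur (k := 2) (by norm_num) ?_
      convert! h using 2 <;> push_cast <;> ring
    convert! norm_lt_norm_mul hx (norm_lt_norm_mul hx h') using 2 <;> simp <;> ring
  reverse := ⟨4, fun x hx => by simp; field_simp; ring⟩

lemma isInnerPair_quintic :
    IsInnerPair (X ^ 5 + C (1 / 2) * X ^ 4 + C (1 / 2) * X)
      (C (1 / 2) * X ^ 4 + C (1 / 2) * X + 1) where
  monic := by monicity!
  degree_lt := by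
    have : (X ^ 5 + C (1 / 2) * X ^ 4 + C (1 / 2) * X : ℂ[X]).degree = 5 := by compute_degree!
    rw [this]
    refine lt_of_le_of_lt (b := 4) (by compute_degree) (by norm_num)
  norm_lt x hx := by
    -- The descent is run backwards: the ratios 2, -3, 4 lead from degree 4 to the linear pair 15x +
    -- 9, 9x + 15.
    have h := norm_lt_norm_mul hx (norm_mul_add_lt (a := 15) (b := 9) (by norm_num) hx)
    have h₂ : ‖x ^ 2 + 3 * x + 4‖ < ‖4 * x ^ 2 + 3 * x + 1‖ := by
      refine norm_lt_norm_of_schur (k := 4) (by norm_num) ?_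
      convert! h using 2 <;> push_cast <;> ring
    have h₃ : ‖-(1 / 2) * x ^ 3 + x + 3 / 2‖ < ‖3 / 2 * x ^ 3 + x ^ 2 - 1 / 2‖ := by
      refine norm_lt_norm_of_schur (k := -3) (by norm_num) ?_
      rw [← norm_neg, ← norm_neg (_ * _ - _)]
      convert! norm_lt_norm_mul hx h₂ using 2 <;> push_cast <;> ring
    have h₄ : ‖1 / 2 * x ^ 4 + 1 / 2 * x + 1‖ < ‖x ^ 4 + 1 / 2 * x ^ 3 + 1 / 2‖ := by
      refine norm_lt_norm_of_schur (k := 2) (by norm_num) ?_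
      convert! norm_lt_norm_mul hx h₃ using 2 <;> push_cast <;> ring
    convert! norm_lt_norm_mul hx h₄ using 2 <;> simp <;> ring
  reverse := ⟨5, fun x hx => by simp; field_simp; ring⟩

end Jensen

/-! ### Integrating Jensen's kernel over y and z. -/

section TorusIntegrals

open Real Set MeasureTheory

lemma integral_zero_pi_abs_cos {h : ℝ → ℝ} (hc : Continuous fun t => h |cos t|) :
    ∫ t in 0..π, h |cos t| = 2 * ∫ t in 0..π / 2, h |cos t| := by
  have hi (a b : ℝ) : IntervalIntegrable (fun t => h |cos t|) volume a b :=
    hc.intervalIntegrable a b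
  rw [← intervalIntegral.integral_add_adjacent_intervals (hi 0 (π / 2)) (hi (π / 2) π)]
  have := intervalIntegral.integral_comp_sub_left (a := 0) (b := π / 2) (fun t => h |cos t|) π
  simp only [cos_pi_sub, abs_neg, sub_zero] at this
  rw [show π - π / 2 = π / 2 by ring] at this
  rw [← this]
  ring

lemma integral_zero_two_pi_abs_cos {h : ℝ → ℝ} (hc : Continuous fun t => h |cos t|) :
    ∫ t in 0..2 * π, h |cos t| = 4 * ∫ t in 0..π / 2, h |cos t| := by
  have hi (a b : ℝ) : IntervalIntegrable (fun t => h |cos t|) volume a b :=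
    hc.intervalIntegrable a b
  rw [← intervalIntegral.integral_add_adjacent_intervals (hi 0 π) (hi π (2 * π))]
  have := intervalIntegral.integral_comp_add_right (a := 0) (b := π) (fun t => h |cos t|) π
  simp only [cos_add_pi, abs_neg, zero_add] at this
  rw [show π + π = 2 * π by ring] at this
  rw [← this, integral_zero_pi_abs_cos hc]
  ring

/-- Jensen's kernel `log max (|1 + u|, |1 - u|)`. -/
noncomputable def logMaxNorm (u : ℂ) : ℝ := log (max ‖1 + u‖ ‖1 - u‖)

/-- The two numbers sum to 2. Hence the kernel is continuous and nonnegative, which later yields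
integrability. -/
lemma one_le_max_norm (u : ℂ) : 1 ≤ max ‖1 + u‖ ‖1 - u‖ := by
  have h : ‖(1 + u) + (1 - u)‖ = 2 := by
    rw [show (1 + u) + (1 - u) = 2 by ring]
    simp
  have h2 := norm_add_le (1 + u) (1 - u)
  by_contra! hlt
  have := max_lt_iff.1 hlt
  linarith

lemma logMaxNorm_nonneg (u : ℂ) : 0 ≤ logMaxNorm u := log_nonneg (one_le_max_norm u)

lemma continuous_logMaxNorm : Continuous logMaxNorm :=
  Continuous.log (by fun_prop) fun u => by linarith [one_le_max_norm u]

lemma logMaxNorm_eq (u : ℂ) : logMaxNorm u = log (1 + ‖u‖ ^ 2 + 2 * |u.re|) / 2 := by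
  have hsq : max ‖1 + u‖ ‖1 - u‖ ^ 2 = 1 + ‖u‖ ^ 2 + 2 * |u.re| := by
    have e1 : ‖1 + u‖ ^ 2 = 1 + ‖u‖ ^ 2 + 2 * u.re := by
      simp only [← Complex.normSq_eq_norm_sq, Complex.normSq_apply, Complex.add_re,
        Complex.add_im, Complex.one_re, Complex.one_im]
      ring
    have e2 : ‖1 - u‖ ^ 2 = 1 + ‖u‖ ^ 2 - 2 * u.re := by
      simp only [← Complex.normSq_eq_norm_sq, Complex.normSq_apply, Complex.sub_re,
        Complex.sub_im, Complex.one_re, Complex.one_im]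
      ring
    rcases le_total 0 u.re with h | h
    · rw [abs_of_nonneg h, max_eq_left (by
        rw [← sq_le_sq₀ (norm_nonneg _) (norm_nonneg _)]; linarith), e1]
    · rw [abs_of_nonpos h, max_eq_right (by
        rw [← sq_le_sq₀ (norm_nonneg _) (norm_nonneg _)]; linarith), e2]
      ring
  rw [← hsq, log_pow, logMaxNorm]
  push_cast
  ring

lemma logMaxNorm_mul_exp (c t : ℝ) :
    logMaxNorm (c * Complex.exp (t * Complex.I)) = log (1 + |c| ^ 2 + 2 * |c| * |cos t|) / 2 := by
  rw [logMaxNorm_eq, norm_mul, Complex.norm_exp_ofReal_mul_I, mul_one, Complex.norm_real,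
    norm_eq_abs, Complex.re_ofReal_mul, Complex.exp_ofReal_mul_I_re, abs_mul]
  ring_nf

lemma one_add_exp_mul_I (t : ℝ) : (1 : ℂ) + Complex.exp (t * Complex.I)
    = ((2 * cos (t / 2) : ℝ) : ℂ) * Complex.exp ((t / 2 : ℝ) * Complex.I) := by
  push_cast
  rw [Complex.two_cos, add_mul, ← Complex.exp_add, ← Complex.exp_add]
  ring_nf
  simp
  ring

lemma exp_mul_I_periodic : Function.Periodic (fun t : ℝ => Complex.exp (t * Complex.I)) (2 * π) :=
  fun t => by
    push_cast
    rw [add_mul, Complex.exp_add, Complex.exp_two_pi_mul_I, mul_one]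

lemma integral_add_of_periodic {f : ℝ → ℝ} (hf : Function.Periodic f (2 * π)) (a : ℝ) :
    ∫ t in 0..2 * π, f (t + a) = ∫ t in 0..2 * π, f t := by
  rw [intervalIntegral.integral_comp_add_right, zero_add, add_comm,
    hf.intervalIntegral_add_eq a 0, zero_add]

/-- Shifting b by a gives e^{ia}(1 + e^{ib}) = 2 cos(b/2) e^{i(a + b/2)}, and periodicity in a
removes the phase b/2. Folding each variable to [0, π/2] contributes a factor 4. -/
lemma integral_torus_logMaxNorm :
    ∫ a in 0..2 * π, ∫ b in 0..2 * π,
      logMaxNorm (Complex.exp (a * Complex.I) + Complex.exp (b * Complex.I))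
      = 16 * (7 / 5 * realPolylog 3 1) := by
  have hpi : (0 : ℝ) ≤ 2 * π := by positivity
  have hT : Continuous fun q : ℝ × ℝ =>
      log (1 + (2 * |cos q.1|) ^ 2 + 2 * (2 * |cos q.1|) * |cos q.2|) / 2 :=
    (Continuous.log (by fun_prop) fun q => by positivity).div_const 2
  have hin : Continuous fun s : ℝ => ∫ t in 0..π / 2,
      log (1 + (2 * |cos s|) ^ 2 + 2 * (2 * |cos s|) * |cos t|) / 2 :=
    intervalIntegral.continuous_parametric_intervalIntegral_of_continuous' hT _ _
  calc _ = ∫ a in 0..2 * π, ∫ b in 0..2 * π, logMaxNorm (Complex.exp (a * Complex.I)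
        + Complex.exp ((b + a : ℝ) * Complex.I)) := by
        refine intervalIntegral.integral_congr fun a _ => ?_
        exact (integral_add_of_periodic (f := fun b => logMaxNorm (Complex.exp (a * Complex.I)
          + Complex.exp (b * Complex.I)))
          (fun t => by simp only [exp_mul_I_periodic t]) a).symm
    _ = ∫ b in 0..2 * π, ∫ a in 0..2 * π, logMaxNorm (Complex.exp (a * Complex.I)
        + Complex.exp ((b + a : ℝ) * Complex.I)) := by
        refine intervalIntegral_swap_of_continuousOn hpi hpi (Continuous.continuousOn ?_)
        exact continuous_logMaxNorm.comp (by fun_prop)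
    _ = ∫ b in 0..2 * π, ∫ a in 0..2 * π, logMaxNorm ((2 * cos (b / 2) : ℝ)
        * Complex.exp (a * Complex.I)) := by
        refine intervalIntegral.integral_congr fun b _ => ?_
        rw [← integral_add_of_periodic (f := fun a => logMaxNorm ((2 * cos (b / 2) : ℝ)
          * Complex.exp (a * Complex.I))) (fun t => by simp only [exp_mul_I_periodic t]) (b / 2)]
        refine intervalIntegral.integral_congr fun a _ => congrArg logMaxNorm ?_
        have := one_add_exp_mul_I b
        push_cast at this ⊢
        rw [add_mul, add_mul, Complex.exp_add, Complex.exp_add]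
        linear_combination Complex.exp (a * Complex.I) * this
    _ = ∫ b in 0..2 * π, 4 * ∫ t in 0..π / 2,
          log (1 + (2 * |cos (b / 2)|) ^ 2 + 2 * (2 * |cos (b / 2)|) * |cos t|) / 2 := by
        refine intervalIntegral.integral_congr fun b _ => ?_
        simp only [logMaxNorm_mul_exp, abs_mul, abs_two]
        exact integral_zero_two_pi_abs_cos (h := fun y =>
          log (1 + (2 * |cos (b / 2)|) ^ 2 + 2 * (2 * |cos (b / 2)|) * y) / 2)
          (hT.comp (f := fun t => (b / 2, t)) (by fun_prop))
    _ = 4 * (2 * ∫ s in 0..π, ∫ t in 0..π / 2,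
          log (1 + (2 * |cos s|) ^ 2 + 2 * (2 * |cos s|) * |cos t|) / 2) := by
        rw [intervalIntegral.integral_const_mul,
          intervalIntegral.integral_comp_div (fun s => ∫ t in 0..π / 2,
            log (1 + (2 * |cos s|) ^ 2 + 2 * (2 * |cos s|) * |cos t|) / 2) two_ne_zero]
        simp
    _ = 16 * ∫ s in 0..π / 2, ∫ t in 0..π / 2,
          log (1 + (2 * |cos s|) ^ 2 + 2 * (2 * |cos s|) * |cos t|) / 2 := by
        rw [integral_zero_pi_abs_cos (h := fun y => ∫ t in 0..π / 2,
          log (1 + (2 * y) ^ 2 + 2 * (2 * y) * |cos t|) / 2) hin]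
        ring
    _ = _ := by
        rw [← integral_integral_log_cos]
        congr 1
        have hcos : ∀ t ∈ uIcc 0 (π / 2), |cos t| = cos t := fun t ht => by
          rw [uIcc_of_le (by positivity)] at ht
          exact abs_of_nonneg (cos_nonneg_of_mem_Icc ⟨by linarith [ht.1, pi_pos], ht.2⟩)
        refine intervalIntegral.integral_congr fun s hs => ?_
        refine intervalIntegral.integral_congr fun t ht => ?_
        simp only [hcos s hs, hcos t ht]

end TorusIntegrals

/-! ### Absolute convergence and assembly of the Mahler measure. -/

section Mahler

open Real Set MeasureTheory Polynomial

/-- Lebesgue measure on `[0, 2π]`. -/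
noncomputable def angleMeasure : Measure ℝ := volume.restrict (Icc 0 (2 * π))

instance : IsFiniteMeasure angleMeasure := by
  unfold angleMeasure
  infer_instance

lemma integral_angleMeasure (f : ℝ → ℝ) :
    ∫ t, f t ∂angleMeasure = ∫ t in 0..2 * π, f t := by
  rw [intervalIntegral.integral_of_le (by positivity), angleMeasure, integral_Icc_eq_integral_Ioc]

lemma volume_restrict_Icc_eq_pi (n : ℕ) :
    (volume : Measure (Fin n → ℝ)).restrict (Icc 0 fun _ => 2 * π)
      = Measure.pi fun _ => angleMeasure := by
  rw [← pi_univ_Icc, volume_pi, Measure.restrict_pi_pi]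
  rfl

lemma integral_eq_circleAverage (f : ℂ → ℝ) :
    ∫ t, f (Complex.exp (t * Complex.I)) ∂angleMeasure = 2 * π * circleAverage f 0 1 := by
  rw [integral_angleMeasure, circleAverage_def, smul_eq_mul, mul_inv_cancel_left₀ (by positivity)]
  simp [circleMap]

/-- The sum `y + z` of the last two coordinates on the torus. -/
noncomputable def expSum (v : Fin 2 → ℝ) : ℂ :=
  Complex.exp (v 0 * Complex.I) + Complex.exp (v 1 * Complex.I)

lemma continuous_expSum : Continuous expSum := by unfold expSum; fun_prop

lemma norm_expSum_le (v : Fin 2 → ℝ) : ‖expSum v‖ ≤ 2 := by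
  refine (norm_add_le _ _).trans ?_
  rw [Complex.norm_exp_ofReal_mul_I, Complex.norm_exp_ofReal_mul_I]
  norm_num

namespace IsInnerPair

variable {A B : ℂ[X]}

/-- The function `log |(1 + y + z) A (x) + (1 - y - z) B (x)|` in angular coordinates. -/
noncomputable def logNorm (A B : ℂ[X]) (q : ℝ × (Fin 2 → ℝ)) : ℝ :=
  log ‖(1 + expSum q.2) * A.eval (Complex.exp (q.1 * Complex.I))
    + (1 - expSum q.2) * B.eval (Complex.exp (q.1 * Complex.I))‖

lemma measurable_logNorm (A B : ℂ[X]) : Measurable (logNorm A B) := by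
  refine measurable_log.comp (Continuous.measurable (Continuous.norm ?_))
  have := continuous_expSum
  fun_prop

lemma logNorm_le (A B : ℂ[X]) : ∃ K, 0 ≤ K ∧ ∀ q, logNorm A B q ≤ K := by
  obtain ⟨a, ha⟩ := (isCompact_sphere (0 : ℂ) 1).exists_bound_of_continuousOn
    A.continuous.continuousOn
  obtain ⟨b, hb⟩ := (isCompact_sphere (0 : ℂ) 1).exists_bound_of_continuousOn
    B.continuous.continuousOn
  have ha0 : 0 ≤ a := (norm_nonneg _).trans (ha 1 (by simp))
  have hb0 : 0 ≤ b := (norm_nonneg _).trans (hb 1 (by simp))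
  refine ⟨3 * a + 3 * b, by positivity, fun q => ?_⟩
  have hx : Complex.exp (q.1 * Complex.I) ∈ Metric.sphere (0 : ℂ) 1 := by
    simp [Complex.norm_exp_ofReal_mul_I]
  have hu := norm_expSum_le q.2
  have h1 : ‖1 + expSum q.2‖ ≤ 3 := (norm_add_le _ _).trans (by rw [norm_one]; linarith)
  have h2 : ‖1 - expSum q.2‖ ≤ 3 := (norm_sub_le _ _).trans (by rw [norm_one]; linarith)
  refine (log_le_self (norm_nonneg _)).trans ((norm_add_le _ _).trans ?_)
  rw [norm_mul, norm_mul]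
  gcongr
  · exact ha _ hx
  · exact hb _ hx

lemma integrable_logNorm_left (A B : ℂ[X]) (v : Fin 2 → ℝ) :
    Integrable (fun t => logNorm A B (t, v)) angleMeasure := by
  have h : CircleIntegrable (fun x => log ‖(1 + expSum v) * A.eval x + (1 - expSum v) * B.eval x‖)
      0 1 := by
    refine MeromorphicOn.circleIntegrable_log_norm fun x _ => ?_
    refine AnalyticAt.meromorphicAt (Differentiable.analyticAt ?_ x)
    fun_prop
  have h2 := (intervalIntegrable_iff_integrableOn_Icc_of_le (by positivity)).1 h
  simp only [circleMap, zero_add, Complex.ofReal_one, one_mul] at h2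
  exact h2

lemma integral_logNorm_left (h : IsInnerPair A B) (v : Fin 2 → ℝ) :
    ∫ t, logNorm A B (t, v) ∂angleMeasure = 2 * π * logMaxNorm (expSum v) := by
  have hne : 1 + expSum v ≠ 0 ∨ 1 - expSum v ≠ 0 := by
    by_contra! hc
    have := one_le_max_norm (expSum v)
    simp only [hc.1, hc.2, norm_zero, max_self] at this
    norm_num at this
  rw [logMaxNorm, ← h.circleAverage_eq hne, ← integral_eq_circleAverage]
  rfl

/-- With f ≤ K and K ≥ 0 one has |f| ≤ 2K - f, and the x-integral of f is nonnegative by Jensen. So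
the x-integrals of |f| are uniformly bounded, despite the zeros of the polynomial on the torus. -/
lemma integrable_logNorm (h : IsInnerPair A B) :
    Integrable (logNorm A B) (angleMeasure.prod (Measure.pi fun _ => angleMeasure)) := by
  have hm := measurable_logNorm A B
  obtain ⟨K, hK0, hK⟩ := logNorm_le A B
  rw [integrable_prod_iff' hm.aestronglyMeasurable]
  refine ⟨Filter.Eventually.of_forall (integrable_logNorm_left A B), ?_⟩
  refine Integrable.of_bound (C := 2 * (angleMeasure.real univ * K)) ?_
    (Filter.Eventually.of_forall fun v => ?_)
  · exact (hm.norm.stronglyMeasurable.integral_prod_left').aestronglyMeasurable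
  · have hi := integrable_logNorm_left A B v
    rw [norm_of_nonneg (integral_nonneg fun _ => norm_nonneg _)]
    have hle : ∫ t, ‖logNorm A B (t, v)‖ ∂angleMeasure
        ≤ ∫ t, (2 * K - logNorm A B (t, v)) ∂angleMeasure := by
      refine integral_mono hi.norm ((integrable_const _).sub hi) fun t => ?_
      simp only [norm_eq_abs]
      have := hK (t, v)
      exact abs_le.2 ⟨by linarith, by linarith⟩
    refine hle.trans ?_
    rw [integral_sub (integrable_const _) hi, integral_const, h.integral_logNorm_left, smul_eq_mul]
    have := logMaxNorm_nonneg (expSum v)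
    have : 0 ≤ 2 * π * logMaxNorm (expSum v) := by positivity
    linarith

lemma integral_logMaxNorm_expSum :
    ∫ v, logMaxNorm (expSum v) ∂(Measure.pi fun _ : Fin 2 => angleMeasure)
      = 16 * (7 / 5 * realPolylog 3 1) := by
  have hmp := measurePreserving_finTwoArrow angleMeasure
  have hc : Continuous fun q : ℝ × ℝ =>
      logMaxNorm (Complex.exp (q.1 * Complex.I) + Complex.exp (q.2 * Complex.I)) :=
    continuous_logMaxNorm.comp (by fun_prop)
  have hi : Integrable (fun q : ℝ × ℝ =>
      logMaxNorm (Complex.exp (q.1 * Complex.I) + Complex.exp (q.2 * Complex.I)))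
      (angleMeasure.prod angleMeasure) := by
    rw [angleMeasure, Measure.prod_restrict]
    exact hc.continuousOn.integrableOn_compact (isCompact_Icc.prod isCompact_Icc)
  have h := hmp.integral_comp' (fun q : ℝ × ℝ =>
      logMaxNorm (Complex.exp (q.1 * Complex.I) + Complex.exp (q.2 * Complex.I)))
  rw [integral_prod _ hi] at h
  simp only [integral_angleMeasure, integral_torus_logMaxNorm] at h
  exact h

lemma integral_logNorm (h : IsInnerPair A B) :
    ∫ q, logNorm A B q ∂(angleMeasure.prod (Measure.pi fun _ => angleMeasure))
      = 2 * π * (16 * (7 / 5 * realPolylog 3 1)) := by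
  rw [integral_prod_symm _ h.integrable_logNorm]
  simp only [h.integral_logNorm_left]
  rw [integral_const_mul, integral_logMaxNorm_expSum]

lemma logNormOnTorus_eq {P : MvPolynomial (Fin 3) ℂ}
    (hP : ∀ x : Fin 3 → ℂ, MvPolynomial.eval x P
      = (1 + (x 1 + x 2)) * A.eval (x 0) + (1 - (x 1 + x 2)) * B.eval (x 0)) :
    logNormOnTorus P
      = logNorm A B ∘ MeasurableEquiv.piFinSuccAbove (fun _ : Fin 3 => ℝ) 0 := by
  funext θ
  simp only [logNormOnTorus, hP, torusMap, Pi.zero_apply, Pi.one_apply, zero_add,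
    Complex.ofReal_one, one_mul]
  rfl

/-- The Mahler measure of `(1 + y + z) A (x) + (1 - y - z) B (x)`. -/
theorem mahler (h : IsInnerPair A B) {P : MvPolynomial (Fin 3) ℂ}
    (hP : ∀ x : Fin 3 → ℂ, MvPolynomial.eval x P
      = (1 + (x 1 + x 2)) * A.eval (x 0) + (1 - (x 1 + x 2)) * B.eval (x 0)) :
    MahlerIntegrable P ∧
      (mvLogMahlerMeasure P : ℂ) = 28 / (5 * (Real.pi : ℂ) ^ 2) * riemannZeta 3 := by
  have hmp := measurePreserving_piFinSuccAbove (fun _ : Fin 3 => angleMeasure) 0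
  constructor
  · rw [MahlerIntegrable, IntegrableOn, volume_restrict_Icc_eq_pi, logNormOnTorus_eq hP]
    exact (hmp.integrable_comp_emb (MeasurableEquiv.measurableEmbedding _)).2 h.integrable_logNorm
  · have hval : mvLogMahlerMeasure P = 28 / (5 * π ^ 2) * realPolylog 3 1 := by
      rw [mvLogMahlerMeasure, volume_restrict_Icc_eq_pi, logNormOnTorus_eq hP]
      have h2 := hmp.integral_comp' (logNorm A B)
      simp only [Function.comp_apply]
      -- The constant is 2π · 16 · (7/5) / (2π)³ = 28/(5π²).
      rw [h2, h.integral_logNorm]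
      have := pi_ne_zero
      field_simp
      ring
    rw [hval, ← realPolylog.three_one]
    push_cast
    ring

end IsInnerPair

end Mahler

open MvPolynomial in
theorem mainTheorem3 :
    ∀ P ∈ ({X 0 ^ 2 + X 0 + 1 + (X 0 ^ 2 - 1) * (X 1 + X 2),
        X 0 ^ 4 - X 0 ^ 3 + X 0 ^ 2 - X 0 + 1
          + (X 0 ^ 4 - X 0 ^ 3 + X 0 - 1) * (X 1 + X 2),
        X 0 ^ 5 + X 0 ^ 4 + X 0 + 1 + (X 0 ^ 5 - 1) * (X 1 + X 2)} :
        Set (MvPolynomial (Fin 3) ℂ)),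
      MahlerIntegrable P ∧
        (mvLogMahlerMeasure P : ℂ) = 28 / (5 * (Real.pi : ℂ) ^ 2) * riemannZeta 3 := by
  rintro P (rfl | rfl | rfl)
  · refine isInnerPair_quadratic.mahler fun x => ?_
    simp
    ring
  · refine isInnerPair_quartic.mahler fun x => ?_
    simp
    ring
  · refine isInnerPair_quintic.mahler fun x => ?_
    simp
    ring
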